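/- Let $N\ge 1$, $q_{o1},\dots,q_{oN}\in\mathbb{R}^n$ (obstacle centres), $d_{s1},\dots,d_{sN}>0$ (safety margins), $h_i(q)=|q_{oi}-q|-d_{si}$, $\underline d_s=\min_i d_{si}$, $\overline d_s=\max_i d_{si}$, where $|\cdot|$ is the Euclidean norm. Let $d_a,d_b,d_h>0$ satisfy $d_a<\underline d_s$, $d_h<\underline d_s$ and the following distance condition: whenever $h_i(q)\ge -d_h$ for all $i$, and $h_j(q)\le d_b/2$, $h_k(q)\le d_b/2$ for some $j,k$, then $|q_{oj}-q_{ok}|\le d_a$. Let $\bar v$ and $d_r>0$ satisfy $$\sqrt2\,\underline d_s>d_a,\qquad \bar v>2d_r,\qquad \frac{2\underline d_s^2-d_a^2}{2(\overline d_s+d_b/2)^2}>1-\frac{(\bar v-2d_r)^2}{2(\bar v-d_r)^2},$$ and put $$c^*=\frac{(2\overline d_s+d_b)^2-4\underline d_s^2+2d_a^2}{2(2\overline d_s+d_b)^2},\qquad D=\sqrt{c^*+\tfrac{d_r}{\bar v-d_r}}-\sqrt{c^*}.$$ A continuous function $\alpha:\mathbb{R}\to\mathbb{R}$ is of class $\mathcal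 K^e$ if it is strictly increasing and $\alpha(0)=0$. Call $(\phi,c_0,\alpha_c,d_f)$ admissible if $\phi:[-1,1]\to[0,\infty)$ is Lipschitz and nonincreasing, $0<c_0<1$, $d_f>0$, $\alpha_c$ is a Lipschitz function of class $\mathcal K^e$, all values of $\alpha_c^{-1}$ below are defined, and $$c_0>\sqrt{c^*}+\sqrt{c^*+\tfrac{d_r}{\bar v-d_r}},\qquad c_0(\bar v-d_r)\ge c_0\alpha_c\left(\tfrac{d_b}{2}\right)-d_r>\frac{d_r-c_0\alpha_c(-d_h)}{D},$$ $$\phi(s)>\max_{p\in[0,d_h]}\ \max_{K\in\left\{c_0(\bar v-d_r),\,\frac{d_r-c_0\alpha_c(-p)}{D}\right\}}\left\{\alpha_c^{-1}\left(\frac{-K(s-c_0)}{c_0}+\frac{-KD+d_r}{c_0}\right)+p\right\}\quad (s\in[-1,c_0)),$$ $$\phi(s)=0\quad(s\in[c_0,1]),$$ $$\alpha_c^{-1}\left(\frac{-c_0\alpha_c(-d_h)+(1+D)d_r}{c_0D}\right)<d_f\le\alpha_c^{-1}\left(\bar v+\left(\tfrac1{c_0}-1\right)d_r\right).$$ Say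 that a finite family of unit vectors $l_1,\dots,l_m\in\mathbb{R}^n$ is a positive basis adapted to $c_0$ if for every unit vector $u\in\mathbb{R}^n$ the set $\{l_p: l_p^Tu\ge c_0\}$ has at least $n$ elements and $u$ is a linear combination of its elements with nonnegative coefficients. For $q\ne q_{o1},\dots,q_{oN}$ let $l_{oi}(q)=(q_{oi}-q)/|q_{oi}-q|$ and $J_N(q,d_f)=\{i: h_i(q)\le d_f\}$. Let $r_k(q,d_f)=\min\{\min_{i\in J_N(q,d_f)}\{h_i(q)+\phi(l_{oi}^T(q)l_k)\},\,d_f\}$ if $J_N(q,d_f)\ne\emptyset$, and $r_k(q,d_f)=d_f$ otherwise. For $v_c\in\mathbb{R}^n$ consider the quadratic program $$v^*=\operatorname*{argmin}_{v\in\mathbb{R}^n}|v-v_c|^2\quad\text{s.t.}\quad l_k^Tv\le c_0\alpha_c(r_k(q,d_f))-d_r,\quad k=1,\dots,m.\qquad(\mathrm{QP})$$ Then there exist an admissible $(\phi,c_0,\alpha_c,d_f)$ and a positive basis adapted to its $c_0$. Moreover, for every admissible $(\phi,c_0,\alpha_c,d_f)$ there is a constant $\Delta_h>0$ such that, for every positive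 basis $l_1,\dots,l_m$ adapted to $c_0$: (a) if $h_i(q)\ge-\Delta_h$ for $i=1,\dots,N$, then (QP) has a unique solution $v^*$ for every $v_c\in\mathbb{R}^n$; (b) for such $q$, $v_c$ and $v^*$, and for every $\tilde v\in\mathbb{R}^n$, with $\dot q=v^*+\tilde v$, each $h_i$ is differentiable at $q$ and $$\frac{\partial h_i(q)}{\partial q}\dot q\ge-\alpha_p(h_i(q))+d_r-|\tilde v|,\quad i=1,\dots,N,\qquad \alpha_p(s)=\max\{\alpha_c(s),c_0\alpha_c(s)\},$$ and $|v^*|\le\bar v-d_r$; (c) there is a constant $L>0$ such that the solution map $v^*=\varphi(q,v_c)$ of (QP) satisfies $|\varphi(q_1,v_{c1})-\varphi(q_2,v_{c2})|\le L(|q_1-q_2|+|v_{c1}-v_{c2}|)$ for all $v_{c1},v_{c2}\in\mathbb{R}^n$ and all $q_1,q_2$ with $h_i(q_1),h_i(q_2)\ge-\Delta_h$ for $i=1,\dots,N$. -/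

import Mathlib

namespace SafetyQP

noncomputable section

/-- The configuration space `ℝⁿ` with its Euclidean norm. -/
abbrev E (n : ℕ) : Type := EuclideanSpace ℝ (Fin n)

/-- A function of class `𝒦ᵉ`: continuous, strictly increasing and zero at zero. -/
structure IsClassKe (α : ℝ → ℝ) : Prop where
  continuous : Continuous α
  strictMono : StrictMono α
  map_zero : α 0 = 0

/-- The barrier function `h(q) = |qo - q| - d` of the ball obstacle with centre `qo` and
safety margin `d`. -/
def barrier {n : ℕ} (qo : E n) (d : ℝ) (q : E n) : ℝ := ‖qo - q‖ - d

/-- The unit vector from `q` to `qo` (used only for `q ≠ qo`). -/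
def dir {n : ℕ} (qo q : E n) : E n := ‖qo - q‖⁻¹ • (qo - q)

/-- The smallest safety margin. -/
def dsMin {N : ℕ} [NeZero N] (ds : Fin N → ℝ) : ℝ :=
  Finset.univ.inf' Finset.univ_nonempty ds

/-- The largest safety margin. -/
def dsMax {N : ℕ} [NeZero N] (ds : Fin N → ℝ) : ℝ :=
  Finset.univ.sup' Finset.univ_nonempty ds

/-- All barrier functions are at least `-δ` at `q`. -/
def IsSafe {n N : ℕ} (qo : Fin N → E n) (ds : Fin N → ℝ) (δ : ℝ) (q : E n) : Prop :=
  ∀ i, -δ ≤ barrier (qo i) (ds i) q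

/-- The distance condition on the obstacles, with constants `da`, `db`, `dh`. -/
structure ObstacleDistance {n N : ℕ} [NeZero N] (qo : Fin N → E n) (ds : Fin N → ℝ)
    (da db dh : ℝ) : Prop where
  da_pos : 0 < da
  da_lt : da < dsMin ds
  db_pos : 0 < db
  dh_pos : 0 < dh
  dh_lt : dh < dsMin ds
  close : ∀ q : E n, IsSafe qo ds dh q → ∀ j k : Fin N,
    barrier (qo j) (ds j) q ≤ db / 2 → barrier (qo k) (ds k) q ≤ db / 2 →
      ‖qo j - qo k‖ ≤ da

/-- The constant `c*`. -/
def cStar {N : ℕ} [NeZero N] (ds : Fin N → ℝ) (da db : ℝ) : ℝ :=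
  ((2 * dsMax ds + db) ^ 2 - 4 * dsMin ds ^ 2 + 2 * da ^ 2) / (2 * (2 * dsMax ds + db) ^ 2)

/-- The constant `√(c* + dr / (vbar - dr)) - √c*`. -/
def gap (c vbar dr : ℝ) : ℝ := √(c + dr / (vbar - dr)) - √c

/-- The inverse `α⁻¹`; it is meaningful on the range of a strictly increasing `α`. -/
def inv (α : ℝ → ℝ) : ℝ → ℝ := Function.invFun α

/-- The requirements on the design parameters `φ`, `c₀`, `αc`, `df` of the controller, where `c`
stands for the constant `c*`. Wherever `αc⁻¹` occurs, its argument is required to belong to the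
range of `αc`. -/
structure IsDesign (c db dh vbar dr : ℝ) (φ : ℝ → ℝ) (c₀ : ℝ) (αc : ℝ → ℝ) (df : ℝ) : Prop where
  phi_lipschitz : ∃ K, LipschitzOnWith K φ (Set.Icc (-1) 1)
  phi_nonneg : ∀ s ∈ Set.Icc (-1 : ℝ) 1, 0 ≤ φ s
  phi_antitone : AntitoneOn φ (Set.Icc (-1) 1)
  c₀_pos : 0 < c₀
  c₀_lt_one : c₀ < 1
  df_pos : 0 < df
  alpha_classKe : IsClassKe αc
  alpha_lipschitz : ∃ K, LipschitzWith K αc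
  c₀_gt : √c + √(c + dr / (vbar - dr)) < c₀
  alpha_le : c₀ * αc (db / 2) - dr ≤ c₀ * (vbar - dr)
  alpha_gt : (dr - c₀ * αc (-dh)) / gap c vbar dr < c₀ * αc (db / 2) - dr
  phi_gt : ∀ s ∈ Set.Ico (-1) c₀, ∀ p ∈ Set.Icc 0 dh,
    ∀ K ∈ ({c₀ * (vbar - dr), (dr - c₀ * αc (-p)) / gap c vbar dr} : Set ℝ),
      -K * (s - c₀) / c₀ + (-K * gap c vbar dr + dr) / c₀ ∈ Set.range αc ∧
      inv αc (-K * (s - c₀) / c₀ + (-K * gap c vbar dr + dr) / c₀) + p < φ s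
  phi_eq_zero : ∀ s ∈ Set.Icc c₀ 1, φ s = 0
  df_lower : (-c₀ * αc (-dh) + (1 + gap c vbar dr) * dr) / (c₀ * gap c vbar dr) ∈ Set.range αc ∧
    inv αc ((-c₀ * αc (-dh) + (1 + gap c vbar dr) * dr) / (c₀ * gap c vbar dr)) < df
  df_upper : vbar + (1 / c₀ - 1) * dr ∈ Set.range αc ∧
    df ≤ inv αc (vbar + (1 / c₀ - 1) * dr)

/-- The family `l₁, …, lₘ` of unit vectors is a positive basis adapted to `c₀`: for every unit
vector `u`, the set `{lₚ : lₚᵀ u ≥ c₀}` has at least `n` elements, and `u` is a positive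
combination (linear combination with nonnegative coefficients) of its elements. In particular
`l₁, …, lₘ` positively span `ℝⁿ`. -/
structure IsPositiveBasis {n m : ℕ} (c₀ : ℝ) (l : Fin m → E n) : Prop where
  unit : ∀ k, ‖l k‖ = 1
  card : ∀ u : E n, ‖u‖ = 1 → n ≤ {x : E n | x ∈ Set.range l ∧ c₀ ≤ inner ℝ x u}.ncard
  comb : ∀ u : E n, ‖u‖ = 1 → ∃ ρ : Fin m → ℝ, (∀ p, 0 ≤ ρ p) ∧
    (∀ p, ρ p ≠ 0 → c₀ ≤ inner ℝ (l p) u) ∧ u = ∑ p, ρ p • l p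

/-- The indices of the obstacles that are near `q`: those with `|q_{oi} - q| - d_{si} ≤ df`. -/
def nearby {n N : ℕ} (qo : Fin N → E n) (ds : Fin N → ℝ) (df : ℝ) (q : E n) : Finset (Fin N) :=
  open Classical in Finset.univ.filter fun i => barrier (qo i) (ds i) q ≤ df

/-- The distance-regularization function in the direction `l`; only nearby obstacles count. -/
def reg {n N : ℕ} (qo : Fin N → E n) (ds : Fin N → ℝ) (φ : ℝ → ℝ) (df : ℝ) (l q : E n) : ℝ :=
  open Classical in
  if hJ : (nearby qo ds df q).Nonempty then
    min ((nearby qo ds df q).inf' hJ fun i =>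
      barrier (qo i) (ds i) q + φ (inner ℝ (dir (qo i) q) l)) df
  else df

/-- The feasible set of the refined quadratic program at `q`. -/
def feasible {n N m : ℕ} (qo : Fin N → E n) (ds : Fin N → ℝ) (φ : ℝ → ℝ) (c₀ : ℝ) (αc : ℝ → ℝ)
    (df dr : ℝ) (l : Fin m → E n) (q : E n) : Set (E n) :=
  {v | ∀ k, inner ℝ (l k) v ≤ c₀ * αc (reg qo ds φ df (l k) q) - dr}

/-- `v` solves the refined quadratic program at `q` with velocity command `vc`. -/
def IsQPSolution {n N m : ℕ} (qo : Fin N → E n) (ds : Fin N → ℝ) (φ : ℝ → ℝ) (c₀ : ℝ)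
    (αc : ℝ → ℝ) (df dr : ℝ) (l : Fin m → E n) (q vc v : E n) : Prop :=
  v ∈ feasible qo ds φ c₀ αc df dr l q ∧
    ∀ w ∈ feasible qo ds φ c₀ αc df dr l q, ‖v - vc‖ ^ 2 ≤ ‖w - vc‖ ^ 2

/-- The function `αp(s) = max {αc(s), c₀ αc(s)}`. -/
def alphaP (c₀ : ℝ) (αc : ℝ → ℝ) (s : ℝ) : ℝ := max (αc s) (c₀ * αc s)

end

end SafetyQP

open Set Filter Topology Finset

/-! The program (QP) projects `vc` onto a polyhedron with fixed normals `l k`; only the right-hand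
sides depend on `q`. Existence and Lipschitz dependence therefore rest on strict feasibility,
uniform bounds on the positive basis, and regularity of the right-hand sides.

Strict feasibility (`IsDesign.exists_strictly_feasible`): the law of cosines bounds the chord
between the directions to two obstacles within `db / 2` by nearly `2√c*`. The requirement on `c₀`
reads `2√c* + D < c₀`, so for a small margin (`exists_safe_margin`) the chord is at most `c₀ - D`.
Retreating from one near obstacle at speed `retreat` then satisfies the constraints coming from all
of them, and the lower bounds on `φ`, `αc (db / 2)` and `df` are what this needs.

Lipschitz dependence (`exists_lipschitz_isNearest`): the active set determines the nearest point as
a linear function of the data. There are finitely many active sets, so one constant serves along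
every segment of data.

Barrier and speed bounds (`IsPositiveBasis.inner_le`): a unit vector is a positive combination, with
coefficient sum in `[1, 1 / c₀]`, of normals close to it. It is applied to the direction to an
obstacle and to the direction of `v`.

Parameters exist because a two-slope `αc`, nearly flat on the negative side, and a steep ramp `φ`
satisfy every strict inequality. -/

namespace SafetyQP

/-! ### Nearest points of polyhedra -/

section QuadraticProgram

variable {V : Type*} [NormedAddCommGroup V] [InnerProductSpace ℝ V] {m : ℕ}

/-- `v` minimises the distance to `c` over the polyhedron `{w | ∀ k, ⟪l k, w⟫ ≤ b k}`. -/
def IsNearest (l : Fin m → V) (b : Fin m → ℝ) (c v : V) : Prop :=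
  (∀ k, inner ℝ (l k) v ≤ b k) ∧ ∀ w, (∀ k, inner ℝ (l k) w ≤ b k) → ‖v - c‖ ^ 2 ≤ ‖w - c‖ ^ 2

lemma convex_polyhedron (l : Fin m → V) (b : Fin m → ℝ) :
    Convex ℝ {w : V | ∀ k, inner ℝ (l k) w ≤ b k} := by
  intro x hx y hy s t hs ht hst k
  simp only [mem_ofPred_eq] at hx hy
  rw [inner_add_right, inner_smul_right, inner_smul_right]
  calc s * inner ℝ (l k) x + t * inner ℝ (l k) y ≤ s * b k + t * b k := by
        gcongr
        · exact hx k
        · exact hy k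
    _ = b k := by rw [← add_mul, hst, one_mul]

lemma isClosed_polyhedron (l : Fin m → V) (b : Fin m → ℝ) :
    IsClosed {w : V | ∀ k, inner ℝ (l k) w ≤ b k} := by
  simp only [ofPred_forall]
  exact isClosed_iInter fun k => isClosed_le (by fun_prop) continuous_const

/-- By the parallelogram law, the midpoint of two distinct minimisers would be strictly closer to
`c`. -/
lemma IsNearest.eq {l : Fin m → V} {b : Fin m → ℝ} {c v w : V} (hv : IsNearest l b c v)
    (hw : IsNearest l b c w) : v = w := by
  have hmid := convex_polyhedron l b hv.1 hw.1
    (by norm_num : (0 : ℝ) ≤ 1 / 2) (by norm_num : (0 : ℝ) ≤ 1 / 2) (by norm_num)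
  have h1 := hv.2 _ hmid
  have h2 := hw.2 _ hv.1
  have h3 := hv.2 _ hw.1
  have h4 := parallelogram_law_with_norm ℝ (v - c) (w - c)
  have h5 : (1 / 2 : ℝ) • v + (1 / 2 : ℝ) • w - c = (1 / 2 : ℝ) • ((v - c) + (w - c)) := by
    module
  rw [h5, norm_smul, mul_pow] at h1
  have h6 : v - c - (w - c) = v - w := by abel
  rw [h6] at h4
  norm_num at h1
  have : ‖v - w‖ * ‖v - w‖ ≤ 0 := by nlinarith
  have h7 : ‖v - w‖ = 0 := by nlinarith [norm_nonneg (v - w)]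
  exact sub_eq_zero.1 (norm_eq_zero.1 h7)

lemma exists_isNearest [CompleteSpace V] {l : Fin m → V} {b : Fin m → ℝ} (c : V)
    (h : ∃ v, ∀ k, inner ℝ (l k) v ≤ b k) : ∃ v, IsNearest l b c v := by
  obtain ⟨v, hv, hmin⟩ := exists_norm_eq_iInf_of_complete_convex (K := {w : V | ∀ k, inner ℝ (l k) w ≤ b k})
    h (isClosed_polyhedron l b).isComplete (convex_polyhedron l b) c
  refine ⟨v, hv, fun w hw => ?_⟩
  rw [norm_sub_rev v, norm_sub_rev w, hmin]
  have : (⨅ w : {w : V | ∀ k, inner ℝ (l k) w ≤ b k}, ‖c - w‖) ≤ ‖c - w‖ :=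
    ciInf_le (f := fun w : {w : V | ∀ k, inner ℝ (l k) w ≤ b k} => ‖c - w‖)
      ⟨0, by rintro _ ⟨z, rfl⟩; exact norm_nonneg _⟩ ⟨w, hw⟩
  have h0 : 0 ≤ (⨅ w : {w : V | ∀ k, inner ℝ (l k) w ≤ b k}, ‖c - w‖) :=
    Real.iInf_nonneg fun _ => norm_nonneg _
  gcongr

/-- The displacement from `c` to its nearest point is orthogonal to every direction along which
all active constraints are constant. -/
lemma IsNearest.inner_eq_zero {l : Fin m → V} {b : Fin m → ℝ} {c v x : V}
    (hv : IsNearest l b c v) (hx : ∀ k, inner ℝ (l k) v = b k → inner ℝ (l k) x = 0) :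
    inner ℝ (v - c) x = 0 := by
  -- Moving along `x` keeps active constraints tight and inactive ones slack for small `t` of either
  -- sign, so `t = 0` is a two-sided local minimum.
  have hfeas : ∀ᶠ t : ℝ in 𝓝 0, ∀ k, inner ℝ (l k) (v + t • x) ≤ b k := by
    rw [eventually_all]
    intro k
    rcases (hv.1 k).eq_or_lt with h | h
    · refine Eventually.of_forall fun t => ?_
      rw [inner_add_right, inner_smul_right, hx k h, mul_zero, add_zero, h]
    · have hc : Continuous fun t : ℝ => inner ℝ (l k) (v + t • x) := by fun_prop
      have := hc.tendsto 0
      simp only [zero_smul, add_zero] at this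
      exact (this.eventually (gt_mem_nhds h)).mono fun t ht => le_of_lt ht
  have hmin : IsLocalMin (fun t : ℝ => ‖v + t • x - c‖ ^ 2) 0 := by
    filter_upwards [hfeas] with t ht
    simpa using hv.2 _ ht
  have hd : HasDerivAt (fun t : ℝ => v + t • x - c) x 0 := by
    simpa using (((hasDerivAt_id (0 : ℝ)).smul_const x).const_add v).sub_const c
  have := hmin.hasDerivAt_eq_zero hd.norm_sq
  simpa using this

/-- The nearest point is always given by one of finitely many linear maps of the data. -/
lemma exists_linear_selections [FiniteDimensional ℝ V] (l : Fin m → V) :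
    ∃ g : Finset (Fin m) → ((Fin m → ℝ) × V →L[ℝ] V),
      ∀ b c v, IsNearest l b c v → ∃ J, v = g J (b, c) := by
  classical
  have key : ∀ J : Finset (Fin m), ∃ g : (Fin m → ℝ) × V →L[ℝ] V, ∀ b c v, IsNearest l b c v →
      J = Finset.univ.filter (fun k => inner ℝ (l k) v = b k) → v = g (b, c) := by
    intro J
    -- For active set `J`, `v` is determined by its products with the active normals, which are the
    -- `b k`, and by its projection to `W`, which equals that of `c`. `Φ` records these data and is
    -- injective; a left inverse gives the linear map.
    let W : Submodule ℝ V := (Submodule.span ℝ (l '' J))ᗮ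
    have hW : ∀ x, x ∈ W ↔ ∀ k ∈ J, inner ℝ (l k) x = 0 := by
      intro x
      constructor
      · intro hx k hk
        exact (Submodule.mem_orthogonal _ _).1 hx _ (Submodule.subset_span ⟨k, hk, rfl⟩)
      · intro hx
        rw [Submodule.mem_orthogonal]
        intro u hu
        induction hu using Submodule.span_induction with
        | mem u hu => obtain ⟨k, hk, rfl⟩ := hu; exact hx k hk
        | zero => simp
        | add u w _ _ hu hw => rw [inner_add_left, hu, hw, add_zero]
        | smul a u _ hu => rw [inner_smul_left, hu, mul_zero]
    let Φ : V →ₗ[ℝ] (Fin m → ℝ) × V :=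
      LinearMap.prod (LinearMap.pi fun k => if k ∈ J then (innerSL ℝ (l k)).toLinearMap else 0)
        (W.starProjection).toLinearMap
    have hΦ : ∀ x, Φ x = (fun k => if k ∈ J then inner ℝ (l k) x else 0, W.starProjection x) := by
      intro x
      refine Prod.ext ?_ rfl
      funext k
      by_cases hk : k ∈ J <;> simp [Φ, hk]
    have hker : LinearMap.ker Φ = ⊥ := by
      rw [LinearMap.ker_eq_bot']
      intro x hx
      rw [hΦ, Prod.mk_eq_zero] at hx
      have hxW : x ∈ W := (hW x).2 fun k hk => by simpa [hk] using congrFun hx.1 k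
      rw [Submodule.starProjection_eq_self_iff.2 hxW] at hx
      exact hx.2
    obtain ⟨G, hG⟩ := Φ.exists_leftInverse_of_injective hker
    let R : (Fin m → ℝ) × V →ₗ[ℝ] (Fin m → ℝ) × V :=
      LinearMap.prodMap (LinearMap.pi fun k => if k ∈ J then LinearMap.proj k else 0)
        (W.starProjection).toLinearMap
    have hR : ∀ b c, R (b, c) = (fun k => if k ∈ J then b k else 0, W.starProjection c) := by
      intro b c
      refine Prod.ext ?_ rfl
      funext k
      by_cases hk : k ∈ J <;> simp [R, hk]
    refine ⟨LinearMap.toContinuousLinearMap (G ∘ₗ R), fun b c v hv hJ => ?_⟩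
    have hact : ∀ k, k ∈ J ↔ inner ℝ (l k) v = b k := by simp [hJ]
    have hperp : v - c ∈ Wᗮ := by
      rw [Submodule.mem_orthogonal']
      intro x hx
      exact hv.inner_eq_zero fun k hk => (hW x).1 hx k ((hact k).2 hk)
    have hproj : W.starProjection v = W.starProjection c := by
      have := (Submodule.starProjection_apply_eq_zero_iff (K := W)).2 hperp
      rwa [map_sub, sub_eq_zero] at this
    have : Φ v = R (b, c) := by
      rw [hΦ, hR, hproj]
      congr 1
      funext k
      by_cases hk : k ∈ J
      · simp [hk, (hact k).1 hk]
      · simp [hk]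
    simp only [LinearMap.coe_toContinuousLinearMap', LinearMap.comp_apply, ← this]
    exact (LinearMap.congr_fun hG v).symm
  choose g hg using key
  exact ⟨g, fun b c v hv => ⟨_, hg _ b c v hv rfl⟩⟩

/-- Limits of nearest points are nearest points, if the limiting constraints are strictly
feasible. -/
lemma IsNearest.of_tendsto {l : Fin m → V} {ι : Type*} {F : Filter ι} [F.NeBot]
    {B : ι → Fin m → ℝ} {C G : ι → V} {b : Fin m → ℝ} {c v : V}
    (hB : Tendsto B F (𝓝 b)) (hC : Tendsto C F (𝓝 c)) (hG : Tendsto G F (𝓝 v))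
    (hstrict : ∃ u, ∀ k, inner ℝ (l k) u < b k) (h : ∀ᶠ i in F, IsNearest l (B i) (C i) (G i)) :
    IsNearest l b c v := by
  have hBk : ∀ k, Tendsto (fun i => B i k) F (𝓝 (b k)) := fun k => (tendsto_pi_nhds.1 hB) k
  -- Strictly feasible competitors remain feasible for nearby `B i`. An arbitrary competitor is
  -- reached by sliding it slightly towards `u`.
  have hstr : ∀ w, (∀ k, inner ℝ (l k) w < b k) → ‖v - c‖ ^ 2 ≤ ‖w - c‖ ^ 2 := by
    intro w hw
    refine le_of_tendsto_of_tendsto (((hG.sub hC).norm).pow 2)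
      (((tendsto_const_nhds.sub hC).norm).pow 2) ?_
    have : ∀ᶠ i in F, ∀ k, inner ℝ (l k) w < B i k :=
      eventually_all.2 fun k => (hBk k).eventually (lt_mem_nhds (hw k))
    filter_upwards [this, h] with i hi hi'
    exact hi'.2 w fun k => (hi k).le
  refine ⟨fun k => ?_, fun w hw => ?_⟩
  · refine le_of_tendsto_of_tendsto (tendsto_const_nhds.inner hG) (hBk k) ?_
    filter_upwards [h] with i hi using hi.1 k
  · obtain ⟨u, hu⟩ := hstrict
    have hcont : Tendsto (fun t : ℝ => ‖(1 - t) • w + t • u - c‖ ^ 2) (𝓝[>] 0) (𝓝 (‖w - c‖ ^ 2)) := by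
      have hc : Continuous fun t : ℝ => ‖(1 - t) • w + t • u - c‖ ^ 2 := by fun_prop
      have := hc.tendsto 0
      simp only [sub_zero, one_smul, zero_smul, add_zero] at this
      exact this.mono_left nhdsWithin_le_nhds
    refine ge_of_tendsto hcont ?_
    have h1 : ∀ᶠ t : ℝ in 𝓝[>] 0, t < 1 :=
      eventually_nhdsWithin_of_eventually_nhds (gt_mem_nhds one_pos)
    filter_upwards [h1, self_mem_nhdsWithin] with t ht1 ht0
    refine hstr _ fun k => ?_
    have ht0' : (0 : ℝ) < t := ht0
    rw [inner_add_right, inner_smul_right, inner_smul_right]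
    nlinarith [hw k, hu k, mul_lt_mul_of_pos_left (hu k) ht0',
      mul_le_mul_of_nonneg_left (hw k) (sub_nonneg.2 ht1.le)]

omit [InnerProductSpace ℝ V] in
/-- A map on an interval that is `C`-Lipschitz on each member of a finite closed cover is
`C`-Lipschitz. -/
lemma norm_sub_le_of_closed_cover {ι : Type*} [DecidableEq ι] {f : ℝ → V} {C : ℝ} {S : ι → Set ℝ}
    (hS : ∀ i, IsClosed (S i)) (hf : ∀ i, ∀ x ∈ S i, ∀ y ∈ S i, x ≤ y → ‖f y - f x‖ ≤ C * (y - x))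
    (s : Finset ι) : ∀ a b : ℝ, a ≤ b → Icc a b ⊆ ⋃ i ∈ s, S i → ‖f b - f a‖ ≤ C * (b - a) := by
  induction s using Finset.strongInduction with
  | H s ih =>
    intro a b hab hcov
    obtain ⟨i, hi, hai⟩ := mem_iUnion₂.1 (hcov ⟨le_rfl, hab⟩)
    have hcpt : IsCompact (Icc a b ∩ S i) := isCompact_Icc.inter_right (hS i)
    have hne : (Icc a b ∩ S i).Nonempty := ⟨a, ⟨le_rfl, hab⟩, hai⟩
    -- `a'` is the last point of `S i`. Beyond it the other sets suffice, and being closed they also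
    -- contain `a'`, so induction applies on `[a', b]`.
    obtain ⟨a', ⟨⟨haa, hab'⟩, hai'⟩, hmax⟩ := hcpt.exists_isGreatest hne
    have h1 := hf i a hai a' hai' haa
    rcases hab'.eq_or_lt with rfl | hlt
    · exact h1
    · have hsub : Ioc a' b ⊆ ⋃ j ∈ s.erase i, S j := by
        intro x hx
        obtain ⟨j, hj, hxj⟩ := mem_iUnion₂.1 (hcov ⟨haa.trans hx.1.le, hx.2⟩)
        refine mem_iUnion₂.2 ⟨j, Finset.mem_erase.2 ⟨?_, hj⟩, hxj⟩
        rintro rfl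
        exact absurd (hmax ⟨⟨haa.trans hx.1.le, hx.2⟩, hxj⟩) (not_le.2 hx.1)
      have hcl : IsClosed (⋃ j ∈ s.erase i, S j) :=
        (s.erase i).finite_toSet.isClosed_biUnion fun j _ => hS j
      have hsub' : Icc a' b ⊆ ⋃ j ∈ s.erase i, S j := by
        rw [← closure_Ioc hlt.ne]
        exact hcl.closure_subset_iff.2 hsub
      have h2 := ih _ (Finset.erase_ssubset hi) a' b hab' hsub'
      calc ‖f b - f a‖ = ‖(f b - f a') + (f a' - f a)‖ := by congr 1; abel
        _ ≤ C * (b - a') + C * (a' - a) := (norm_add_le _ _).trans (add_le_add h2 h1)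
        _ = C * (b - a) := by ring

/-- The nearest point of a strictly feasible polyhedron with fixed normals depends Lipschitz
continuously on the right-hand side and on the target. -/
theorem exists_lipschitz_isNearest [FiniteDimensional ℝ V] (l : Fin m → V) :
    ∃ L : ℝ, 0 < L ∧ ∀ b₁ b₂ c₁ c₂ v₁ v₂, (∃ u, ∀ k, inner ℝ (l k) u < b₁ k) →
      (∃ u, ∀ k, inner ℝ (l k) u < b₂ k) → IsNearest l b₁ c₁ v₁ → IsNearest l b₂ c₂ v₂ →
        ‖v₁ - v₂‖ ≤ L * (‖b₁ - b₂‖ + ‖c₁ - c₂‖) := by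
  classical
  have : CompleteSpace V := FiniteDimensional.complete ℝ V
  obtain ⟨g, hg⟩ := exists_linear_selections l
  set L : ℝ := (∑ J, ‖g J‖) + 1 with hL
  have hLpos : 0 < L := by positivity
  have hgL : ∀ J, ‖g J‖ ≤ L := fun J => by
    have := Finset.single_le_sum (f := fun J => ‖g J‖) (fun J _ => norm_nonneg (g J))
      (Finset.mem_univ J)
    linarith
  refine ⟨L, hLpos, ?_⟩
  rintro b₁ b₂ c₁ c₂ v₁ v₂ ⟨u₁, hu₁⟩ ⟨u₂, hu₂⟩ hv₁ hv₂
  set p : ℝ → (Fin m → ℝ) × V := fun t => (b₁, c₁) + t • (b₂ - b₁, c₂ - c₁) with hp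
  have hpc : Continuous p := by fun_prop
  have hstrict : ∀ t ∈ Icc (0 : ℝ) 1, ∃ u, ∀ k, inner ℝ (l k) u < (p t).1 k := by
    intro t ht
    refine ⟨(1 - t) • u₁ + t • u₂, fun k => ?_⟩
    have e : (p t).1 k = (1 - t) * b₁ k + t * b₂ k := by simp [hp]; ring
    rw [e, inner_add_right, inner_smul_right, inner_smul_right]
    rcases ht.1.eq_or_lt with h0 | h0
    · simpa [← h0] using hu₁ k
    · have := mul_lt_mul_of_pos_left (hu₂ k) h0
      have := mul_le_mul_of_nonneg_left (hu₁ k).le (sub_nonneg.2 ht.2)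
      linarith
  have hex : ∀ t, ∃ v, t ∈ Icc (0 : ℝ) 1 → IsNearest l (p t).1 (p t).2 v := by
    intro t
    by_cases ht : t ∈ Icc (0 : ℝ) 1
    · obtain ⟨u, hu⟩ := hstrict t ht
      obtain ⟨v, hv⟩ := exists_isNearest (p t).2 ⟨u, fun k => (hu k).le⟩
      exact ⟨v, fun _ => hv⟩
    · exact ⟨0, fun h => absurd h ht⟩
  choose f hf using hex
  -- The times at which selection `J` gives the nearest point; closed because strict feasibility
  -- persists along the segment `p`.
  set S : Finset (Fin m) → Set ℝ :=
    fun J => {t | t ∈ Icc (0 : ℝ) 1 ∧ IsNearest l (p t).1 (p t).2 (g J (p t))} with hS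
  have hclosed : ∀ J, IsClosed (S J) := by
    intro J
    refine isClosed_of_closure_subset fun t ht => ?_
    have ht01 : t ∈ Icc (0 : ℝ) 1 :=
      closure_minimal (fun x (hx : x ∈ S J) => hx.1) isClosed_Icc ht
    have := mem_closure_iff_nhdsWithin_neBot.1 ht
    refine ⟨ht01, IsNearest.of_tendsto (F := 𝓝[S J] t) (B := fun t => (p t).1)
      (C := fun t => (p t).2) (G := fun t => g J (p t)) ?_ ?_ ?_ (hstrict t ht01) ?_⟩
    · exact (hpc.fst.tendsto t).mono_left nhdsWithin_le_nhds
    · exact (hpc.snd.tendsto t).mono_left nhdsWithin_le_nhds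
    · exact (((g J).continuous.comp hpc).tendsto t).mono_left nhdsWithin_le_nhds
    · filter_upwards [self_mem_nhdsWithin] with x hx using hx.2
  have hlip : ∀ J, ∀ x ∈ S J, ∀ y ∈ S J, x ≤ y →
      ‖f y - f x‖ ≤ (L * (‖b₁ - b₂‖ + ‖c₁ - c₂‖)) * (y - x) := by
    intro J x hx y hy hxy
    rw [(hf y hy.1).eq hy.2, (hf x hx.1).eq hx.2, ← map_sub]
    have e : p y - p x = (y - x) • (b₂ - b₁, c₂ - c₁) := by
      simp only [hp]; module
    have hn : ‖(b₂ - b₁, c₂ - c₁)‖ ≤ ‖b₁ - b₂‖ + ‖c₁ - c₂‖ := by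
      rw [Prod.norm_def, norm_sub_rev b₁, norm_sub_rev c₁]
      exact max_le (by simp) (by simp)
    rw [e]
    calc ‖g J ((y - x) • (b₂ - b₁, c₂ - c₁))‖ ≤ ‖g J‖ * ‖(y - x) • (b₂ - b₁, c₂ - c₁)‖ :=
          (g J).le_opNorm _
      _ = ‖g J‖ * ‖(b₂ - b₁, c₂ - c₁)‖ * (y - x) := by
          rw [norm_smul, Real.norm_of_nonneg (sub_nonneg.2 hxy)]; ring
      _ ≤ (L * (‖b₁ - b₂‖ + ‖c₁ - c₂‖)) * (y - x) := by
          have := sub_nonneg.2 hxy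
          gcongr
          exact hgL J
  have hcov : Icc (0 : ℝ) 1 ⊆ ⋃ J ∈ (Finset.univ : Finset (Finset (Fin m))), S J := by
    intro t ht
    obtain ⟨J, hJ⟩ := hg _ _ _ (hf t ht)
    refine mem_iUnion₂.2 ⟨J, Finset.mem_univ _, ht, ?_⟩
    rw [show g J (p t) = f t from hJ.symm]
    exact hf t ht
  have h := norm_sub_le_of_closed_cover hclosed hlip Finset.univ 0 1 zero_le_one hcov
  have h0 : f 0 = v₁ := by
    refine (hf 0 ⟨le_rfl, zero_le_one⟩).eq ?_
    simpa [hp] using hv₁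
  have h1 : f 1 = v₂ := by
    refine (hf 1 ⟨zero_le_one, le_rfl⟩).eq ?_
    simpa [hp] using hv₂
  rw [h0, h1, norm_sub_rev] at h
  simpa using h

end QuadraticProgram

/-! ### Existence of positive bases -/

/-- Finitely many unit vectors such that every unit vector is a positive combination of those
that are `c`-close to it. -/
lemma exists_conic_net {n : ℕ} {c : ℝ} (hc1 : c < 1) :
    ∃ (m : ℕ) (l : Fin m → E n), (∀ k, ‖l k‖ = 1) ∧
      ∀ u : E n, ‖u‖ = 1 → ∃ ρ : Fin m → ℝ, (∀ p, 0 ≤ ρ p) ∧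
        (∀ p, ρ p ≠ 0 → c ≤ inner ℝ (l p) u) ∧ u = ∑ p, ρ p • l p := by
  classical
  have hloc : ∀ u : E n, ‖u‖ = 1 → ∃ b : Fin (Module.finrank ℝ (E n) + 1) → E n,
      (∀ j, b j ≠ 0) ∧ ∃ U ∈ 𝓝 u, ∀ u' ∈ U, u' ∈ convexHull ℝ (range b) ∧
        ∀ j, c ≤ inner ℝ (‖b j‖⁻¹ • b j) u' := by
    intro u hu
    have hu0 : u ≠ 0 := by rintro rfl; simp at hu
    have hs : {z : E n | z ≠ 0 ∧ c < inner ℝ (‖z‖⁻¹ • z) u} ∈ 𝓝 u := by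
      refine inter_mem (isOpen_ne.mem_nhds hu0) ?_
      have hcont : ContinuousAt (fun z : E n => inner ℝ (‖z‖⁻¹ • z) u) u := by
        have : ‖u‖ ≠ 0 := norm_ne_zero_iff.2 hu0
        fun_prop (disch := assumption)
      refine hcont.eventually (lt_mem_nhds ?_)
      simp [hu, hc1]
    -- A small simplex around `u`: its vertices, once normalised, serve all nearby unit vectors.
    -- Compactness of the sphere leaves finitely many simplices.
    obtain ⟨b, hb1, hb2⟩ := exists_mem_interior_convexHull_affineBasis hs
    have hbj : ∀ j, b j ∈ {z : E n | z ≠ 0 ∧ c < inner ℝ (‖z‖⁻¹ • z) u} := fun j =>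
      hb2 (subset_convexHull ℝ _ ⟨j, rfl⟩)
    refine ⟨b, fun j => (hbj j).1, _, inter_mem (mem_interior_iff_mem_nhds.1 hb1)
      (eventually_all.2 fun j => ?_ : ∀ᶠ u' in 𝓝 u, ∀ j, c ≤ inner ℝ (‖b j‖⁻¹ • b j) u'),
      fun u' hu' => hu'⟩
    have hcont : Continuous fun u' : E n => inner ℝ (‖b j‖⁻¹ • b j) u' := by fun_prop
    exact ((hcont.tendsto u).eventually (lt_mem_nhds (hbj j).2)).mono fun _ h => le_of_lt h
  choose! b hb0 U hU hUb using hloc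
  obtain ⟨t, ht, hcov⟩ := (isCompact_sphere (0 : E n) 1).elim_nhds_subcover U
    fun u hu => hU u (by simpa using hu)
  have ht1 : ∀ x ∈ t, ‖x‖ = 1 := fun x hx => by simpa using ht x hx
  let ι := t × Fin (Module.finrank ℝ (E n) + 1)
  let e : Fin (Fintype.card ι) ≃ ι := (Fintype.equivFin ι).symm
  let L : ι → E n := fun i => ‖b i.1 i.2‖⁻¹ • b i.1 i.2
  refine ⟨Fintype.card ι, fun k => L (e k), fun k => ?_, fun u hu => ?_⟩
  · exact norm_smul_inv_norm (𝕜 := ℝ) (hb0 _ (ht1 _ (e k).1.2) _)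
  · obtain ⟨x, hx, hux⟩ := mem_iUnion₂.1 (hcov (by simpa using hu : u ∈ Metric.sphere (0 : E n) 1))
    obtain ⟨hconv, hin⟩ := hUb x (ht1 x hx) u hux
    rw [convexHull_range_eq_exists_affineCombination] at hconv
    obtain ⟨s, w, hw0, hw1, hw⟩ := hconv
    rw [s.affineCombination_eq_linear_combination _ _ hw1] at hw
    let ρ : ι → ℝ := fun i => if i.1 = ⟨x, hx⟩ ∧ i.2 ∈ s then w i.2 * ‖b x i.2‖ else 0
    refine ⟨fun k => ρ (e k), fun k => ?_, fun k hk => ?_, ?_⟩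
    · simp only [ρ]
      split_ifs with h
      · exact mul_nonneg (hw0 _ h.2) (norm_nonneg _)
      · exact le_rfl
    · simp only [ρ] at hk
      have h := (ite_ne_right_iff.1 hk).1.1
      simp only [L]
      rw [h]
      exact hin _
    · rw [e.sum_comp (fun i => ρ i • L i), Fintype.sum_prod_type, Finset.sum_eq_single ⟨x, hx⟩]
      · rw [← hw, ← Finset.sum_subset (Finset.subset_univ s)]
        · refine Finset.sum_congr rfl fun j hj => ?_
          have : ‖b x j‖ ≠ 0 := norm_ne_zero_iff.2 (hb0 x (ht1 x hx) j)
          simp [ρ, L, hj, smul_smul, this]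
        · intro j _ hj
          simp [ρ, hj]
      · intro y _ hy
        refine Finset.sum_eq_zero fun j _ => ?_
        simp [ρ, hy]
      · simp

/-- Positive bases adapted to any `c₀ < 1` exist. -/
theorem exists_isPositiveBasis {n : ℕ} {c₀ : ℝ} (h1 : c₀ < 1) :
    ∃ (m : ℕ) (l : Fin m → E n), IsPositiveBasis c₀ l := by
  -- The finer level `(1 + c₀) / 2` leaves slack `(1 - c₀) / 2`: vectors used for a `u'` that close
  -- to `u` belong to the set of `u`.
  obtain ⟨m, l, hl, hcomb⟩ := exists_conic_net (n := n) (c := (1 + c₀) / 2) (by linarith)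
  refine ⟨m, l, hl, fun u hu => ?_, fun u hu => ?_⟩
  · by_contra hlt
    push Not at hlt
    set A : Set (E n) := {x : E n | x ∈ Set.range l ∧ c₀ ≤ inner ℝ x u} with hA
    have hfin : A.Finite := (Set.finite_range l).subset fun x hx => hx.1
    have hspan : Submodule.span ℝ A ≠ ⊤ := by
      intro htop
      let _ : Fintype A := hfin.fintype
      have h := finrank_span_le_card (R := ℝ) A
      rw [htop, finrank_top, finrank_euclideanSpace_fin] at h
      rw [Set.ncard_eq_toFinset_card A hfin] at hlt
      have e : A.toFinset = hfin.toFinset := by ext; simp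
      rw [e] at h
      omega
    have hu0 : u ≠ 0 := by rintro rfl; simp at hu
    have hnear : ∀ᶠ z in 𝓝 u, z ≠ 0 ∧ ‖‖z‖⁻¹ • z - u‖ < (1 - c₀) / 2 := by
      refine Filter.Eventually.and (isOpen_ne.mem_nhds hu0) ?_
      have hcont : ContinuousAt (fun z : E n => ‖‖z‖⁻¹ • z - u‖) u := by
        have : ‖u‖ ≠ 0 := norm_ne_zero_iff.2 hu0
        fun_prop (disch := assumption)
      refine hcont.eventually (gt_mem_nhds ?_)
      simp only [hu, inv_one, one_smul, sub_self, norm_zero]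
      linarith
    -- Fewer than `n` vectors span a proper subspace, which misses some `u'` near `u`; yet `u'` is a
    -- combination of those very vectors.
    have hdense : Dense ((Submodule.span ℝ A : Set (E n))ᶜ) := by
      rw [← interior_eq_empty_iff_dense_compl]
      by_contra hne
      exact hspan (Submodule.eq_top_of_nonempty_interior' _ (nonempty_iff_ne_empty.2 hne))
    obtain ⟨z, hzA, hz0, hz⟩ := hdense.inter_nhds_nonempty hnear
    set u' := ‖z‖⁻¹ • z with hu'
    have hu'1 : ‖u'‖ = 1 := norm_smul_inv_norm (𝕜 := ℝ) hz0
    obtain ⟨ρ, -, hρ, hsum⟩ := hcomb u' hu'1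
    have hmem : u' ∈ Submodule.span ℝ A := by
      rw [hsum]
      refine Submodule.sum_mem _ fun p _ => ?_
      by_cases hp : ρ p = 0
      · simp [hp]
      · refine Submodule.smul_mem _ _ (Submodule.subset_span ⟨⟨p, rfl⟩, ?_⟩)
        have h2 := hρ p hp
        have h3 : inner ℝ (l p) (u' - u) ≤ ‖u' - u‖ := by
          simpa [hl p] using real_inner_le_norm (l p) (u' - u)
        rw [inner_sub_right] at h3
        linarith
    apply hzA
    have hzn : ‖z‖ ≠ 0 := norm_ne_zero_iff.2 hz0
    have : z = ‖z‖ • u' := by rw [hu', smul_smul, mul_inv_cancel₀ hzn, one_smul]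
    rw [this]
    exact Submodule.smul_mem _ _ hmem
  · obtain ⟨ρ, h0, hρ, hsum⟩ := hcomb u hu
    exact ⟨ρ, h0, fun p hp => by have := hρ p hp; linarith, hsum⟩

/-! ### The constants `c*` and `D` -/

lemma dsMin_le_dsMax {N : ℕ} [NeZero N] (ds : Fin N → ℝ) : dsMin ds ≤ dsMax ds :=
  (Finset.inf'_le ds (Finset.mem_univ 0)).trans (Finset.le_sup' ds (Finset.mem_univ 0))

/-- The right-hand side is the bound of `norm_dir_sub_dir_sq_le` at margin zero, so `2√c*` is the
limiting chord. -/
lemma cStar_eq {N : ℕ} [NeZero N] (ds : Fin N → ℝ) {da db : ℝ} (hpos : 0 < 2 * dsMax ds + db) :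
    4 * cStar ds da db =
      2 - (2 * dsMin ds ^ 2 - da ^ 2) / (dsMax ds + db / 2) ^ 2 := by
  have h1 : 2 * dsMax ds + db = 2 * (dsMax ds + db / 2) := by ring
  have h2 : dsMax ds + db / 2 ≠ 0 := by
    intro h
    rw [h1, h] at hpos
    simp at hpos
  rw [cStar, h1]
  field_simp
  ring

lemma cStar_pos {N : ℕ} [NeZero N] {ds : Fin N → ℝ} {da db : ℝ} (hda : 0 < da) (hdb : 0 < db)
    (hmin : 0 < dsMin ds) : 0 < cStar ds da db := by
  have h := dsMin_le_dsMax ds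
  have : 0 < 2 * dsMax ds + db := by linarith
  rw [cStar]
  apply div_pos _ (by positivity)
  have h1 : 4 * dsMin ds ^ 2 ≤ (2 * dsMax ds + db) ^ 2 := by nlinarith
  have := sq_pos_of_pos hda
  linarith

lemma gap_pos {c vbar dr : ℝ} (hc : 0 ≤ c) (hdr : 0 < dr) (h2 : 2 * dr < vbar) :
    0 < gap c vbar dr := by
  have : 0 < dr / (vbar - dr) := div_pos hdr (by linarith)
  exact sub_pos.2 (Real.sqrt_lt_sqrt hc (by linarith))

/-- Difference of squares; it turns the lower bound on `c₀` into `dr < c₀ * (vbar - dr) * D`. -/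
lemma gap_mul_add {c vbar dr : ℝ} (hc : 0 ≤ c) (hdr : 0 < dr) (h2 : 2 * dr < vbar) :
    gap c vbar dr * (√c + √(c + dr / (vbar - dr))) = dr / (vbar - dr) := by
  have : 0 < dr / (vbar - dr) := div_pos hdr (by linarith)
  have e1 := Real.sq_sqrt hc
  have e2 := Real.sq_sqrt (by linarith : 0 ≤ c + dr / (vbar - dr))
  rw [gap]
  linear_combination e2 - e1

/-- With `r = dr / (vbar - dr)` the hypothesis says `2√c < 1 - r`, which is `√(c + r) < 1 - √c`
after squaring. -/
lemma sqrt_add_sqrt_lt_one {c vbar dr : ℝ} (hc : 0 ≤ c) (hdr : 0 < dr) (h2 : 2 * dr < vbar)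
    (h : 4 * c < (vbar - 2 * dr) ^ 2 / (vbar - dr) ^ 2) :
    √c + √(c + dr / (vbar - dr)) < 1 := by
  have hv : 0 < vbar - dr := by linarith
  set r := dr / (vbar - dr) with hr
  have e : (vbar - 2 * dr) / (vbar - dr) = 1 - r := by
    rw [hr]; field_simp; ring
  have hr1 : 0 < 1 - r := by rw [← e]; exact div_pos (by linarith) hv
  rw [← div_pow, e] at h
  have h3 : 2 * √c < 1 - r := by
    have e1 := Real.sq_sqrt hc
    nlinarith [Real.sqrt_nonneg c]
  have hr0 : 0 < r := div_pos hdr hv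
  have h4 : √(c + r) < 1 - √c := by
    rw [Real.sqrt_lt' (by linarith)]
    have e1 := Real.sq_sqrt hc
    nlinarith
  linarith

/-! ### Existence of design parameters -/

/-- The function with slopes `a` for positive and `b` for negative arguments. -/
def bilinear (a b s : ℝ) : ℝ := a * max s 0 + b * min s 0

lemma bilinear_of_nonneg {a b s : ℝ} (hs : 0 ≤ s) : bilinear a b s = a * s := by
  simp [bilinear, hs]

lemma bilinear_of_nonpos {a b s : ℝ} (hs : s ≤ 0) : bilinear a b s = b * s := by
  simp [bilinear, hs]

lemma bilinear_sub_ge {a b s t : ℝ} (hab : b ≤ a) (hst : s ≤ t) :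
    b * (t - s) ≤ bilinear a b t - bilinear a b s := by
  rcases le_total 0 s with h | h
  · rw [bilinear_of_nonneg h, bilinear_of_nonneg (h.trans hst)]
    nlinarith
  · rcases le_total 0 t with h' | h'
    · rw [bilinear_of_nonpos h, bilinear_of_nonneg h']
      nlinarith
    · rw [bilinear_of_nonpos h, bilinear_of_nonpos h']
      nlinarith

lemma bilinear_continuous (a b : ℝ) : Continuous (bilinear a b) := by
  unfold bilinear; fun_prop

lemma bilinear_strictMono {a b : ℝ} (hb : 0 < b) (hab : b ≤ a) : StrictMono (bilinear a b) := by
  intro s t hst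
  have := bilinear_sub_ge hab hst.le
  have := mul_pos hb (sub_pos.2 hst)
  linarith

lemma bilinear_surjective {a b : ℝ} (ha : 0 < a) (hb : 0 < b) :
    Function.Surjective (bilinear a b) := by
  intro y
  rcases le_total 0 y with h | h
  · exact ⟨y / a, by rw [bilinear_of_nonneg (by positivity)]; field_simp⟩
  · exact ⟨y / b, by
      rw [bilinear_of_nonpos (div_nonpos_of_nonpos_of_nonneg h hb.le)]; field_simp⟩

lemma bilinear_lipschitz {a b : ℝ} : ∃ K, LipschitzWith K (bilinear a b) := by
  have h1 : LipschitzWith 1 (fun s : ℝ => max s 0) := LipschitzWith.id.max_const 0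
  have h2 : LipschitzWith 1 (fun s : ℝ => min s 0) := LipschitzWith.id.min_const 0
  exact ⟨_, (LipschitzWith.comp (lipschitzWith_smul a) h1).add
    (LipschitzWith.comp (lipschitzWith_smul b) h2)⟩

lemma apply_inv {α : ℝ → ℝ} {y : ℝ} (hy : y ∈ range α) : α (inv α y) = y :=
  Function.invFun_eq hy

/-- Admissible design parameters exist. -/
theorem exists_isDesign {c db dh vbar dr : ℝ} (hc : 0 ≤ c) (hdb : 0 < db) (hdh : 0 < dh)
    (hdr : 0 < dr) (h2 : 2 * dr < vbar) (h1 : √c + √(c + dr / (vbar - dr)) < 1) :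
    ∃ (φ : ℝ → ℝ) (c₀ : ℝ) (αc : ℝ → ℝ) (df : ℝ), IsDesign c db dh vbar dr φ c₀ αc df := by
  have hv : 0 < vbar - dr := by linarith
  obtain ⟨c₀, hc₀, hc₁⟩ := exists_between h1
  have hsum : 0 ≤ √c + √(c + dr / (vbar - dr)) := by positivity
  have hpos : 0 < c₀ := hsum.trans_lt hc₀
  have hD := gap_pos hc hdr h2
  have hDm := gap_mul_add hc hdr h2
  set D := gap c vbar dr with hDdef
  have hslack : dr < c₀ * (vbar - dr) * D := by
    have h3 : dr / (vbar - dr) < D * c₀ := by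
      rw [← hDm]; exact mul_lt_mul_of_pos_left hc₀ hD
    rw [div_lt_iff₀ hv] at h3
    linarith
  -- Chosen so that `α (db / 2) = M` and `df = db / 2` turn `alpha_le` and `df_upper` into
  -- equalities.
  set M := (vbar - dr) + dr / c₀ with hM
  have hMpos : 0 < M := by positivity
  set a := M / (db / 2) with ha
  have hapos : 0 < a := by positivity
  -- A small negative-side slope makes `α (-dh)` so close to zero that the slack `hslack` absorbs
  -- it.
  obtain ⟨b, hb0, hb1⟩ : ∃ b, 0 < b ∧ b < min a ((c₀ * (vbar - dr) * D - dr) / (c₀ * dh)) :=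
    exists_between (lt_min hapos (div_pos (sub_pos.2 hslack) (by positivity)))
  have hba : b ≤ a := (hb1.trans_le (min_le_left _ _)).le
  have hbD : dr + c₀ * (b * dh) < c₀ * (vbar - dr) * D := by
    have := hb1.trans_le (min_le_right _ _)
    rw [lt_div_iff₀ (by positivity)] at this
    linarith
  set α := bilinear a b with hα
  have hmono : StrictMono α := bilinear_strictMono hb0 hba
  have hsurj : Function.Surjective α := bilinear_surjective hapos hb0
  have hα1 : α (db / 2) = M := by
    rw [hα, bilinear_of_nonneg (by positivity), ha]; field_simp
  have hα2 : ∀ p, 0 ≤ p → α (-p) = -(b * p) := by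
    intro p hp
    rw [hα, bilinear_of_nonpos (by linarith)]; ring
  have hrange : ∀ y, y ∈ range α := fun y => hsurj y
  have hinv : ∀ y, α (inv α y) = y := fun y => apply_inv (hrange y)
  have hcM : c₀ * M - dr = c₀ * (vbar - dr) := by rw [hM]; field_simp; ring
  set K₁ := c₀ * (vbar - dr) with hK₁
  have hK₁pos : 0 < K₁ := by positivity
  -- `K₁ / c₀ / b` is the slope required of `φ` below `c₀`; the added 1 gives strictness.
  set Λ := K₁ / c₀ / b + 1 with hΛ
  have hΛpos : 0 < Λ := by positivity
  refine ⟨fun s => Λ * max (c₀ - s) 0, c₀, α, db / 2, ?_⟩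
  refine
    { phi_lipschitz := ?_
      phi_nonneg := fun s _ => by positivity
      phi_antitone := fun s _ t _ hst => by
        dsimp only
        gcongr
      c₀_pos := hpos
      c₀_lt_one := hc₁
      df_pos := by positivity
      alpha_classKe := ⟨bilinear_continuous a b, hmono, by simp [hα, bilinear]⟩
      alpha_lipschitz := bilinear_lipschitz
      c₀_gt := hc₀
      alpha_le := by rw [hα1, hcM]
      alpha_gt := ?_
      phi_gt := ?_
      phi_eq_zero := fun s hs => by
        simp [hs.1]
      df_lower := ⟨hrange _, ?_⟩
      df_upper := ⟨hrange _, ?_⟩ }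
  · have h3 : LipschitzWith (1 + 0) (fun s : ℝ => max (c₀ - s) 0) := by
      have : LipschitzWith 1 (fun s : ℝ => c₀ - s) :=
        LipschitzWith.of_dist_le_mul fun x y => by rw [dist_sub_left]; simp
      simpa using this.max_const 0
    exact ⟨_, ((lipschitzWith_smul Λ).comp h3).lipschitzOnWith⟩
  · rw [hα1, hcM, div_lt_iff₀ hD, hα2 dh hdh.le]
    linarith
  · intro s hs p hp K hK
    refine ⟨hrange _, ?_⟩
    set y := -K * (s - c₀) / c₀ + (-K * D + dr) / c₀ with hy
    have hKle : K ≤ K₁ ∧ (dr - c₀ * α (-p)) / D ≤ K := by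
      have h4 : (dr - c₀ * α (-p)) / D ≤ K₁ := by
        rw [div_le_iff₀ hD, hα2 p hp.1]
        have : c₀ * (b * p) ≤ c₀ * (b * dh) := by
          have := hp.2
          gcongr
        linarith
      rcases hK with rfl | rfl
      · exact ⟨le_rfl, h4⟩
      · exact ⟨h4, le_rfl⟩
    have hsc : 0 < c₀ - s := sub_pos.2 hs.2
    -- The upper bound on `K` controls the slope in `s`, the lower bound gives `dr - K * D ≤ c₀ * α
    -- (-p)`.
    have hy1 : y ≤ K₁ / c₀ * (c₀ - s) + α (-p) := by
      have h5 := hKle.2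
      rw [div_le_iff₀ hD] at h5
      have h6 : K * (c₀ - s) ≤ K₁ * (c₀ - s) := by
        have := hKle.1
        gcongr
      have h7 : y = (K * (c₀ - s) + (dr - K * D)) / c₀ := by rw [hy]; ring
      rw [h7, div_le_iff₀ hpos]
      have : (K₁ / c₀ * (c₀ - s) + α (-p)) * c₀ = K₁ * (c₀ - s) + c₀ * α (-p) := by
        field_simp
      rw [this]
      linarith
    have h8 : inv α y + p ≤ K₁ / c₀ / b * (c₀ - s) := by
      rcases le_total (inv α y) (-p) with h | h
      · have : 0 ≤ K₁ / c₀ / b * (c₀ - s) := by positivity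
        linarith
      · have h9 := bilinear_sub_ge hba h
        rw [← hα, hinv] at h9
        have : b * (inv α y + p) ≤ K₁ / c₀ * (c₀ - s) := by linarith
        have e : K₁ / c₀ / b * (c₀ - s) = (K₁ / c₀ * (c₀ - s)) / b := by ring
        rw [e, le_div_iff₀ hb0]
        linarith
    change inv α y + p < Λ * max (c₀ - s) 0
    rw [max_eq_left hsc.le, hΛ]
    linarith
  · rw [← hmono.lt_iff_lt, hinv, hα1, div_lt_iff₀ (by positivity), hα2 dh hdh.le]
    have : M * (c₀ * D) = (c₀ * (vbar - dr) + dr) * D := by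
      rw [← hK₁, ← hcM]; ring
    rw [this]
    linarith
  · rw [← hmono.le_iff_le, hinv, hα1, hM]
    apply le_of_eq
    ring

/-! ### Directions, barriers and the law of cosines -/

lemma norm_mul_norm_mul_sq {V : Type*} [NormedAddCommGroup V] [InnerProductSpace ℝ V] {x y : V}
    (hx : x ≠ 0) (hy : y ≠ 0) :
    ‖x‖ * ‖y‖ * ‖‖x‖⁻¹ • x - ‖y‖⁻¹ • y‖ ^ 2 = ‖x - y‖ ^ 2 - (‖x‖ - ‖y‖) ^ 2 := by
  have hx' : ‖x‖ ≠ 0 := norm_ne_zero_iff.2 hx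
  have hy' : ‖y‖ ≠ 0 := norm_ne_zero_iff.2 hy
  rw [norm_sub_sq_real, norm_sub_sq_real, real_inner_smul_left, real_inner_smul_right, norm_smul,
    norm_smul, norm_inv, norm_inv, norm_norm, norm_norm]
  field_simp
  ring

section Geometry

variable {n : ℕ} {qo q : E n}

lemma norm_dir (h : q ≠ qo) : ‖dir qo q‖ = 1 :=
  norm_smul_inv_norm (𝕜 := ℝ) (sub_ne_zero.2 h.symm)

lemma norm_dir_le : ‖dir qo q‖ ≤ 1 := by
  rcases eq_or_ne q qo with rfl | h
  · simp [dir]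
  · exact (norm_dir h).le

lemma dir_lipschitz {r : ℝ} (hr : 0 < r) {q₁ q₂ : E n} (h₁ : r ≤ ‖qo - q₁‖)
    (h₂ : r ≤ ‖qo - q₂‖) : ‖dir qo q₁ - dir qo q₂‖ ≤ r⁻¹ * ‖q₁ - q₂‖ := by
  have e := norm_mul_norm_mul_sq (norm_pos_iff.1 (hr.trans_le h₁)) (norm_pos_iff.1 (hr.trans_le h₂))
  have e' : qo - q₁ - (qo - q₂) = -(q₁ - q₂) := by abel
  rw [e', norm_neg] at e
  rw [inv_mul_eq_div, le_div_iff₀ hr]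
  refine abs_le_of_sq_le_sq' ?_ (norm_nonneg _) |>.2
  calc (‖dir qo q₁ - dir qo q₂‖ * r) ^ 2 = r * r * ‖dir qo q₁ - dir qo q₂‖ ^ 2 := by ring
    _ ≤ ‖qo - q₁‖ * ‖qo - q₂‖ * ‖dir qo q₁ - dir qo q₂‖ ^ 2 := by gcongr
    _ ≤ ‖q₁ - q₂‖ ^ 2 := by
      rw [dir, dir, e]
      nlinarith [sq_nonneg (‖qo - q₁‖ - ‖qo - q₂‖)]

lemma abs_barrier_sub_le (qo : E n) (d : ℝ) (q₁ q₂ : E n) :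
    |barrier qo d q₁ - barrier qo d q₂| ≤ ‖q₁ - q₂‖ := by
  have h := abs_norm_sub_norm_le (qo - q₁) (qo - q₂)
  have e' : qo - q₁ - (qo - q₂) = -(q₁ - q₂) := by abel
  rw [e', norm_neg] at h
  simpa [barrier] using h

lemma hasFDerivAt_barrier (d : ℝ) (h : q ≠ qo) :
    HasFDerivAt (barrier qo d) (-(innerSL ℝ (dir qo q))) q := by
  have h0 : qo - q ≠ 0 := sub_ne_zero.2 h.symm
  have hn : ‖qo - q‖ ≠ 0 := norm_ne_zero_iff.2 h0
  have h1 : HasFDerivAt (fun x : E n => qo - x) (-(ContinuousLinearMap.id ℝ (E n))) q :=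
    (hasFDerivAt_id q).const_sub qo
  have h2 := (h1.norm_sq.sqrt (pow_ne_zero 2 hn)).sub_const d
  have e : barrier qo d = fun x => √(‖qo - x‖ ^ 2) - d := by
    funext x
    rw [Real.sqrt_sq (norm_nonneg _), barrier]
  rw [e]
  refine h2.congr_fderiv ?_
  ext x
  simp only [Real.sqrt_sq (norm_nonneg _), dir]
  simp
  field_simp
  ring

/-- The cosine law bound for the angle between the directions to two obstacles. -/
lemma norm_dir_sub_dir_sq_le {q₁ q₂ : E n} {da r R : ℝ} (hr : 0 < r) (hda : da ^ 2 ≤ 2 * r ^ 2)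
    (h₁ : r ≤ ‖q₁ - q‖) (h₂ : r ≤ ‖q₂ - q‖) (h₁' : ‖q₁ - q‖ ≤ R) (h₂' : ‖q₂ - q‖ ≤ R)
    (h : ‖q₁ - q₂‖ ≤ da) :
    ‖dir q₁ q - dir q₂ q‖ ^ 2 ≤ 2 - (2 * r ^ 2 - da ^ 2) / R ^ 2 := by
  have ha := hr.trans_le h₁
  have hb := hr.trans_le h₂
  have e := norm_mul_norm_mul_sq (norm_pos_iff.1 ha) (norm_pos_iff.1 hb)
  have e' : q₁ - q - (q₂ - q) = q₁ - q₂ := by abel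
  rw [e'] at e
  change ‖q₁ - q‖ * ‖q₂ - q‖ * ‖dir q₁ q - dir q₂ q‖ ^ 2 = _ at e
  set a := ‖q₁ - q‖
  set b := ‖q₂ - q‖
  set X := ‖dir q₁ q - dir q₂ q‖ ^ 2
  have hab : 0 < a * b := mul_pos ha hb
  have habR : a * b ≤ R ^ 2 := by nlinarith
  have hsq : ‖q₁ - q₂‖ ^ 2 ≤ da ^ 2 := by gcongr
  -- After clearing denominators this is `2 * r ^ 2 ≤ a ^ 2 + b ^ 2`.
  have h3 : X ≤ 2 - (2 * r ^ 2 - da ^ 2) / (a * b) := by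
    rw [le_sub_iff_add_le, ← le_sub_iff_add_le', div_le_iff₀ hab]
    nlinarith
  have h4 : (2 * r ^ 2 - da ^ 2) / R ^ 2 ≤ (2 * r ^ 2 - da ^ 2) / (a * b) :=
    div_le_div_of_nonneg_left (by linarith) hab habR
  linarith

end Geometry

/-! ### The regularized distance -/

section Regularization

variable {n N : ℕ} {qo : Fin N → E n} {ds : Fin N → ℝ} {φ : ℝ → ℝ} {df : ℝ} {l q : E n}

lemma inner_dir_mem_Icc (qo q : E n) (hl : ‖l‖ = 1) : inner ℝ (dir qo q) l ∈ Icc (-1 : ℝ) 1 := by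
  have h := abs_real_inner_le_norm (dir qo q) l
  rw [hl, mul_one] at h
  exact abs_le.1 (h.trans norm_dir_le)

/-- Since `φ ≥ 0`, obstacles beyond `df` never lower the minimum, so changes of the nearby set are
invisible to `reg`. -/
lemma le_reg_iff (hφ : ∀ i, 0 ≤ φ (inner ℝ (dir (qo i) q) l)) {x : ℝ} :
    x ≤ reg qo ds φ df l q ↔
      x ≤ df ∧ ∀ i, x ≤ barrier (qo i) (ds i) q + φ (inner ℝ (dir (qo i) q) l) := by
  have hfar : ∀ i, i ∉ nearby qo ds df q → x ≤ df →
      x ≤ barrier (qo i) (ds i) q + φ (inner ℝ (dir (qo i) q) l) := by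
    intro i hi hx
    have : df < barrier (qo i) (ds i) q := by simpa [nearby] using hi
    linarith [hφ i]
  unfold reg
  split_ifs with hJ
  · rw [le_min_iff, Finset.le_inf'_iff]
    constructor
    · rintro ⟨h1, h2⟩
      refine ⟨h2, fun i => ?_⟩
      by_cases hi : i ∈ nearby qo ds df q
      · exact h1 i hi
      · exact hfar i hi h2
    · rintro ⟨h1, h2⟩
      exact ⟨fun i _ => h2 i, h1⟩
  · refine ⟨fun h => ⟨h, fun i => hfar i (fun hi => hJ ⟨i, hi⟩) h⟩, fun h => h.1⟩

lemma reg_eq_or :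
    reg qo ds φ df l q = df ∨
      ∃ i, reg qo ds φ df l q = barrier (qo i) (ds i) q + φ (inner ℝ (dir (qo i) q) l) := by
  unfold reg
  split_ifs with hJ
  · rcases min_choice ((nearby qo ds df q).inf' hJ fun i =>
      barrier (qo i) (ds i) q + φ (inner ℝ (dir (qo i) q) l)) df with h | h
    · obtain ⟨i, -, hi⟩ := Finset.exists_mem_eq_inf' hJ fun i =>
        barrier (qo i) (ds i) q + φ (inner ℝ (dir (qo i) q) l)
      exact Or.inr ⟨i, by rw [h, hi]⟩
    · exact Or.inl h
  · exact Or.inl rfl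

lemma reg_lipschitz (hl : ‖l‖ = 1) (hφ0 : ∀ s ∈ Icc (-1 : ℝ) 1, 0 ≤ φ s) {K : NNReal}
    (hφ : LipschitzOnWith K φ (Icc (-1) 1)) {r : ℝ} (hr : 0 < r) {q₁ q₂ : E n}
    (h₁ : ∀ i, r ≤ ‖qo i - q₁‖) (h₂ : ∀ i, r ≤ ‖qo i - q₂‖) :
    |reg qo ds φ df l q₁ - reg qo ds φ df l q₂| ≤ (1 + K * r⁻¹) * ‖q₁ - q₂‖ := by
  have key : ∀ q₁ q₂ : E n, (∀ i, r ≤ ‖qo i - q₁‖) → (∀ i, r ≤ ‖qo i - q₂‖) →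
      reg qo ds φ df l q₁ - (1 + K * r⁻¹) * ‖q₁ - q₂‖ ≤ reg qo ds φ df l q₂ := by
    intro q₁ q₂ h₁ h₂
    obtain ⟨hdf, hi⟩ := (le_reg_iff (qo := qo) (ds := ds) (df := df)
      fun i => hφ0 _ (inner_dir_mem_Icc (qo i) q₁ hl)).1 le_rfl
    refine (le_reg_iff fun i => hφ0 _ (inner_dir_mem_Icc (qo i) q₂ hl)).2 ⟨?_, fun i => ?_⟩
    · have : 0 ≤ (1 + K * r⁻¹) * ‖q₁ - q₂‖ := by positivity
      linarith
    · have hb := (abs_le.1 (abs_barrier_sub_le (qo i) (ds i) q₁ q₂)).2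
      have hp := hφ.dist_le_mul _ (inner_dir_mem_Icc (qo i) q₁ hl) _
        (inner_dir_mem_Icc (qo i) q₂ hl)
      rw [Real.dist_eq, Real.dist_eq, ← inner_sub_left] at hp
      have hin : |inner ℝ (dir (qo i) q₁ - dir (qo i) q₂) l| ≤ r⁻¹ * ‖q₁ - q₂‖ := by
        refine (abs_real_inner_le_norm _ _).trans ?_
        rw [hl, mul_one]
        exact dir_lipschitz hr (h₁ i) (h₂ i)
      have hp' := (abs_le.1 (hp.trans (mul_le_mul_of_nonneg_left hin K.2))).2
      have := hi i
      linarith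
  rw [abs_le]
  have k1 := key q₁ q₂ h₁ h₂
  have k2 := key q₂ q₁ h₂ h₁
  rw [norm_sub_rev q₂] at k2
  constructor <;> linarith

end Regularization

/-! ### Projection bounds and the safety margin -/

/-- A bound on the constraints of a positive basis near a direction bounds the component of the
velocity along that direction. -/
lemma IsPositiveBasis.inner_le {n m : ℕ} {c₀ B : ℝ} {l : Fin m → E n} (hl : IsPositiveBasis c₀ l)
    (hc₀ : 0 < c₀) {u v : E n} (hu : ‖u‖ = 1)
    (h : ∀ p, c₀ ≤ inner ℝ (l p) u → inner ℝ (l p) v ≤ B) : inner ℝ u v ≤ max (B / c₀) B := by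
  obtain ⟨ρ, hρ0, hρ, hsum⟩ := hl.comb u hu
  have h1 : ∑ p, ρ p * inner ℝ (l p) u = 1 := by
    have : inner ℝ u u = ∑ p, ρ p * inner ℝ (l p) u := by
      nth_rewrite 1 [hsum]
      rw [sum_inner]
      exact Finset.sum_congr rfl fun p _ => real_inner_smul_left _ _ _
    rw [← this, real_inner_self_eq_norm_sq, hu, one_pow]
  -- Pairing `u` with itself puts the coefficient sum in `[1, 1 / c₀]`; the sign of `B` decides
  -- which end is worst.
  have hlow : c₀ * ∑ p, ρ p ≤ 1 := by
    rw [← h1, Finset.mul_sum]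
    refine Finset.sum_le_sum fun p _ => ?_
    by_cases hp : ρ p = 0
    · simp [hp]
    · rw [mul_comm]
      exact mul_le_mul_of_nonneg_left (hρ p hp) (hρ0 p)
  have hupp : 1 ≤ ∑ p, ρ p := by
    rw [← h1]
    refine Finset.sum_le_sum fun p _ => mul_le_of_le_one_right (hρ0 p) ?_
    simpa [hl.unit p, hu] using real_inner_le_norm (l p) u
  have hv : inner ℝ u v ≤ (∑ p, ρ p) * B := by
    rw [hsum, sum_inner, Finset.sum_mul]
    refine Finset.sum_le_sum fun p _ => ?_
    rw [real_inner_smul_left]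
    by_cases hp : ρ p = 0
    · simp [hp]
    · exact mul_le_mul_of_nonneg_left (h p (hρ p hp)) (hρ0 p)
  refine hv.trans ?_
  rcases le_total 0 B with hB | hB
  · refine le_max_of_le_left ?_
    rw [le_div_iff₀ hc₀]
    nlinarith
  · exact le_max_of_le_right (by nlinarith)

lemma IsSafe.le_norm {n N : ℕ} [NeZero N] {qo : Fin N → E n} {ds : Fin N → ℝ} {δ : ℝ} {q : E n}
    (h : IsSafe qo ds δ q) (i : Fin N) : dsMin ds - δ ≤ ‖qo i - q‖ := by
  have h1 := h i
  have h2 : dsMin ds ≤ ds i := Finset.inf'_le ds (Finset.mem_univ i)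
  rw [barrier] at h1
  linarith

/-- For a small enough `Δ`, the directions to two close obstacles differ by at most `e`, uniformly
over the configurations that are safe with margin `-Δ`. -/
lemma exists_safe_margin {n N : ℕ} [NeZero N] {qo : Fin N → E n} {ds : Fin N → ℝ} {da db dh e : ℝ}
    (hobs : ObstacleDistance qo ds da db dh) (h1 : da < √2 * dsMin ds) (he : 0 ≤ e)
    (hce : 4 * cStar ds da db < e ^ 2) :
    ∃ Δ, 0 < Δ ∧ Δ < dh ∧ ∀ q, IsSafe qo ds Δ q → ∀ j k, barrier (qo j) (ds j) q ≤ db / 2 →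
      barrier (qo k) (ds k) q ≤ db / 2 → ‖dir (qo j) q - dir (qo k) q‖ ≤ e := by
  have hmin : 0 < dsMin ds := hobs.da_pos.trans hobs.da_lt
  have hdb := hobs.db_pos
  have hmm := dsMin_le_dsMax ds
  rw [cStar_eq ds (by linarith)] at hce
  set R := dsMax ds + db / 2 with hR
  have hRpos : 0 < R := by linarith
  have hsq : da ^ 2 < 2 * dsMin ds ^ 2 := by
    have := pow_lt_pow_left₀ h1 hobs.da_pos.le two_ne_zero
    rwa [mul_pow, Real.sq_sqrt (by norm_num)] at this
  -- Both needed inequalities are strict at `Δ = 0`, hence survive a small positive `Δ`.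
  have hc1 : ContinuousAt (fun Δ : ℝ => 2 * (dsMin ds - Δ) ^ 2) 0 := by fun_prop
  have hc2 : ContinuousAt (fun Δ : ℝ => 2 - (2 * (dsMin ds - Δ) ^ 2 - da ^ 2) / R ^ 2) 0 := by
    have : R ^ 2 ≠ 0 := by positivity
    fun_prop (disch := assumption)
  have e1 : ∀ᶠ Δ : ℝ in 𝓝 0, da ^ 2 < 2 * (dsMin ds - Δ) ^ 2 :=
    hc1.eventually (lt_mem_nhds (by simpa using hsq))
  have e2 : ∀ᶠ Δ : ℝ in 𝓝 0, 2 - (2 * (dsMin ds - Δ) ^ 2 - da ^ 2) / R ^ 2 < e ^ 2 :=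
    hc2.eventually (gt_mem_nhds (by simpa using hce))
  have e3 : ∀ᶠ Δ : ℝ in 𝓝 0, Δ < dh := gt_mem_nhds hobs.dh_pos
  have e4 : ∀ᶠ Δ : ℝ in 𝓝[>] 0, 0 < Δ := self_mem_nhdsWithin
  obtain ⟨Δ, ⟨⟨h1, h2⟩, h3⟩, h4⟩ :=
    ((((e1.and e2).and e3).filter_mono nhdsWithin_le_nhds).and e4).exists
  refine ⟨Δ, h4, h3, fun q hq j k hj hk => ?_⟩
  have hclose := hobs.close q (fun i => by linarith [hq i]) j k hj hk
  have hdh := hobs.dh_lt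
  have hle : ∀ i, barrier (qo i) (ds i) q ≤ db / 2 → ‖qo i - q‖ ≤ R := by
    intro i hi
    have : ds i ≤ dsMax ds := Finset.le_sup' ds (Finset.mem_univ i)
    rw [barrier] at hi
    linarith
  have := norm_dir_sub_dir_sq_le (by linarith) h1.le (hq.le_norm j) (hq.le_norm k) (hle j hj)
    (hle k hk) hclose
  exact abs_le_of_sq_le_sq' (this.trans h2.le) he |>.2

/-! ### Feasibility and properties of the control law -/

section Design

variable {n N : ℕ} {qo : Fin N → E n} {ds : Fin N → ℝ} {c db dh vbar dr : ℝ}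
  {φ : ℝ → ℝ} {c₀ : ℝ} {αc : ℝ → ℝ} {df : ℝ}

/-- The admissible retreat speed. -/
noncomputable def retreat (c dh vbar dr c₀ : ℝ) (αc : ℝ → ℝ) : ℝ := (dr - c₀ * αc (-dh)) / gap c vbar dr

lemma IsDesign.retreat_pos (hd : IsDesign c db dh vbar dr φ c₀ αc df) (hdh : 0 < dh) (hdr : 0 < dr)
    (hD : 0 < gap c vbar dr) : 0 < retreat c dh vbar dr c₀ αc := by
  have h := hd.alpha_classKe.strictMono (neg_lt_zero.2 hdh)
  rw [hd.alpha_classKe.map_zero] at h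
  have := mul_pos hd.c₀_pos (neg_pos.2 h)
  exact div_pos (by linarith) hD

lemma IsDesign.retreat_lt_df (hd : IsDesign c db dh vbar dr φ c₀ αc df)
    (hD : 0 < gap c vbar dr) : retreat c dh vbar dr c₀ αc < c₀ * αc df - dr := by
  have h := hd.alpha_classKe.strictMono hd.df_lower.2
  rw [apply_inv hd.df_lower.1, div_lt_iff₀ (mul_pos hd.c₀_pos hD)] at h
  rw [retreat, div_lt_iff₀ hD]
  linarith

/-- Moving away from any nearby obstacle at the retreat speed is strictly feasible. -/
lemma IsDesign.exists_strictly_feasible (hd : IsDesign c db dh vbar dr φ c₀ αc df) (hdh : 0 < dh)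
    (hdr : 0 < dr) (hD : 0 < gap c vbar dr) {Δ : ℝ} (hΔ : Δ < dh) {q : E n}
    (hq : IsSafe qo ds Δ q)
    (hdir : ∀ j k, barrier (qo j) (ds j) q ≤ db / 2 → barrier (qo k) (ds k) q ≤ db / 2 →
      ‖dir (qo j) q - dir (qo k) q‖ ≤ c₀ - gap c vbar dr)
    {m : ℕ} {l : Fin m → E n} (hl : ∀ k, ‖l k‖ = 1) :
    ∃ u, ∀ k, inner ℝ (l k) u < c₀ * αc (reg qo ds φ df (l k) q) - dr := by
  have hmono := hd.alpha_classKe.strictMono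
  have hc₀ := hd.c₀_pos
  have hKdf := hd.retreat_lt_df hD
  have hKpos := hd.retreat_pos hdh hdr hD
  have hKdb : retreat c dh vbar dr c₀ αc < c₀ * αc (db / 2) - dr := hd.alpha_gt
  have hKdh : retreat c dh vbar dr c₀ αc * gap c vbar dr = dr - c₀ * αc (-dh) := by
    rw [retreat]; field_simp
  -- The condition on `φ` at `p = dh`, where its second choice of `K` is the retreat speed.
  have hphi : ∀ s ∈ Ico (-1) c₀, -retreat c dh vbar dr c₀ αc * (s - c₀ + gap c vbar dr) <
      c₀ * αc (φ s - dh) - dr := by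
    intro s hs
    obtain ⟨hr, hlt⟩ := hd.phi_gt s hs dh ⟨hdh.le, le_rfl⟩ (retreat c dh vbar dr c₀ αc) (Or.inr rfl)
    have h := hmono (lt_sub_iff_add_lt.2 hlt)
    rw [apply_inv hr, ← add_div, div_lt_iff₀ hc₀] at h
    linarith
  set K := retreat c dh vbar dr c₀ αc
  set D := gap c vbar dr
  have hfar : ∀ k i, db / 2 < barrier (qo i) (ds i) q →
      K < c₀ * αc (barrier (qo i) (ds i) q + φ (inner ℝ (dir (qo i) q) (l k))) - dr := by
    intro k i hi
    have h0 := hd.phi_nonneg _ (inner_dir_mem_Icc (qo i) q (hl k))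
    have := mul_lt_mul_of_pos_left
      (hmono (by linarith : db / 2 < barrier (qo i) (ds i) q + φ (inner ℝ (dir (qo i) q) (l k)))) hc₀
    linarith
  by_cases hnear : ∃ j, barrier (qo j) (ds j) q ≤ db / 2
  · obtain ⟨j, hj⟩ := hnear
    refine ⟨-K • dir (qo j) q, fun k => ?_⟩
    rw [inner_smul_right]
    have hin : -K * inner ℝ (l k) (dir (qo j) q) ≤ K := by
      have := (inner_dir_mem_Icc (qo j) q (hl k)).1
      rw [real_inner_comm] at this
      nlinarith
    rcases reg_eq_or (qo := qo) (ds := ds) (φ := φ) (df := df) (l := l k) (q := q) with h | ⟨i, h⟩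
    · rw [h]; linarith
    · rw [h]
      rcases lt_or_ge (db / 2) (barrier (qo i) (ds i) q) with hi | hi
      · exact hin.trans_lt (hfar k i hi)
      · have hs := inner_dir_mem_Icc (qo i) q (hl k)
        -- Replacing obstacle `i` by `j` costs at most the chord `c₀ - D`.
        have hw : inner ℝ (dir (qo i) q) (l k) - c₀ + D ≤ inner ℝ (l k) (dir (qo j) q) := by
          have h1 := real_inner_le_norm (dir (qo i) q - dir (qo j) q) (l k)
          rw [hl k, mul_one, inner_sub_left, real_inner_comm (l k) (dir (qo j) q)] at h1
          have := hdir i j hi hj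
          linarith
        set s := inner ℝ (dir (qo i) q) (l k)
        have h2 : -K * inner ℝ (l k) (dir (qo j) q) ≤ -K * (s - c₀ + D) := by nlinarith
        have hqi := hq i
        refine h2.trans_lt ?_
        rcases lt_or_ge s c₀ with hsc | hsc
        · refine (hphi s ⟨hs.1, hsc⟩).trans ?_
          have := mul_lt_mul_of_pos_left
            (hmono (by linarith : φ s - dh < barrier (qo i) (ds i) q + φ s)) hc₀
          linarith
        -- Here `s - c₀ + D ≥ D`, and `-K * D` equals `c₀ * αc (-dh) - dr`.
        · rw [hd.phi_eq_zero s ⟨hsc, hs.2⟩, add_zero]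
          have := mul_lt_mul_of_pos_left
            (hmono (by linarith : -dh < barrier (qo i) (ds i) q)) hc₀
          nlinarith
  · push Not at hnear
    refine ⟨0, fun k => ?_⟩
    rw [inner_zero_right]
    rcases reg_eq_or (qo := qo) (ds := ds) (φ := φ) (df := df) (l := l k) (q := q) with h | ⟨i, h⟩
    · rw [h]; linarith
    · rw [h]; linarith [hfar k i (hnear i)]

variable {m : ℕ} {l : Fin m → E n}

/-- Normals within the cone `c₀` around the obstacle direction see `φ = 0`, so their constraints are
bounded through the barrier value itself. -/
lemma IsDesign.inner_dir_le (hd : IsDesign c db dh vbar dr φ c₀ αc df) (hdr : 0 < dr)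
    (hl : IsPositiveBasis c₀ l) {q v : E n} (hv : v ∈ feasible qo ds φ c₀ αc df dr l q) (i : Fin N)
    (hqi : q ≠ qo i) :
    inner ℝ (dir (qo i) q) v ≤ alphaP c₀ αc (barrier (qo i) (ds i) q) - dr := by
  have hc₀ := hd.c₀_pos
  have h := hl.inner_le hc₀ (norm_dir hqi) (v := v)
    (B := c₀ * αc (barrier (qo i) (ds i) q) - dr) fun p hp => by
      refine (hv p).trans ?_
      have h1 := ((le_reg_iff (qo := qo) (ds := ds) (df := df)
        fun i => hd.phi_nonneg _ (inner_dir_mem_Icc (qo i) q (hl.unit p))).1 le_rfl).2 i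
      rw [real_inner_comm] at hp
      rw [hd.phi_eq_zero _ ⟨hp, (inner_dir_mem_Icc (qo i) q (hl.unit p)).2⟩, add_zero] at h1
      have := mul_le_mul_of_nonneg_left (hd.alpha_classKe.strictMono.monotone h1) hc₀.le
      linarith
  refine h.trans (max_le ?_ ?_)
  · have h1 : (c₀ * αc (barrier (qo i) (ds i) q) - dr) / c₀ =
        αc (barrier (qo i) (ds i) q) - dr / c₀ := by field_simp
    have h2 : dr ≤ dr / c₀ := by
      rw [le_div_iff₀ hc₀]
      nlinarith [hd.c₀_lt_one]
    have := le_max_left (αc (barrier (qo i) (ds i) q)) (c₀ * αc (barrier (qo i) (ds i) q))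
    rw [h1, alphaP]
    linarith
  · exact sub_le_sub_right (le_max_right _ _) _

/-- Every `reg` is at most `df`; in the direction of `v` this gives `‖v‖ ≤ αc df - dr / c₀`, and
`df_upper` is tailored to that. -/
lemma IsDesign.norm_le (hd : IsDesign c db dh vbar dr φ c₀ αc df) (hdh : 0 < dh) (hdr : 0 < dr)
    (hD : 0 < gap c vbar dr) (h2 : 2 * dr < vbar)
    (hl : IsPositiveBasis c₀ l) {q v : E n} (hv : v ∈ feasible qo ds φ c₀ αc df dr l q) :
    ‖v‖ ≤ vbar - dr := by
  have hc₀ := hd.c₀_pos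
  have hmono := hd.alpha_classKe.strictMono
  rcases eq_or_ne v 0 with rfl | hv0
  · rw [norm_zero]; linarith
  have hn : ‖v‖ ≠ 0 := norm_ne_zero_iff.2 hv0
  have h := hl.inner_le hc₀ (norm_smul_inv_norm (𝕜 := ℝ) hv0) (v := v)
    (B := c₀ * αc df - dr) fun p _ => by
      refine (hv p).trans ?_
      have h1 := ((le_reg_iff (qo := qo) (ds := ds) (df := df)
        fun i => hd.phi_nonneg _ (inner_dir_mem_Icc (qo i) q (hl.unit p))).1 le_rfl).1
      have := mul_le_mul_of_nonneg_left (hmono.monotone h1) hc₀.le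
      linarith
  have hB : 0 < c₀ * αc df - dr := (hd.retreat_pos hdh hdr hD).trans (hd.retreat_lt_df hD)
  have hmax : max ((c₀ * αc df - dr) / c₀) (c₀ * αc df - dr) = (c₀ * αc df - dr) / c₀ := by
    apply max_eq_left
    rw [le_div_iff₀ hc₀]
    nlinarith [hd.c₀_lt_one]
  have hdf := hmono.monotone hd.df_upper.2
  rw [apply_inv hd.df_upper.1] at hdf
  have hvv : inner ℝ (((‖v‖ : ℝ)⁻¹ : ℝ) • v) v = ‖v‖ := by
    rw [real_inner_smul_left, real_inner_self_eq_norm_sq]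
    field_simp
  have h' : ‖v‖ ≤ (c₀ * αc df - dr) / c₀ := by
    rw [← hmax]
    exact hvv.symm.le.trans h
  have e : (c₀ * αc df - dr) / c₀ = αc df - 1 / c₀ * dr := by field_simp
  rw [e] at h'
  linarith

lemma IsDesign.exists_lipschitz (hd : IsDesign c db dh vbar dr φ c₀ αc df)
    (hl : ∀ k, ‖l k‖ = 1) {r : ℝ} (hr : 0 < r) {Q : Set (E n)}
    (hQ : ∀ q ∈ Q, ∀ i, r ≤ ‖qo i - q‖)
    (hfeas : ∀ q ∈ Q, ∃ u, ∀ k, inner ℝ (l k) u < c₀ * αc (reg qo ds φ df (l k) q) - dr) :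
    ∃ L : ℝ, 0 < L ∧ ∀ q₁ q₂, q₁ ∈ Q → q₂ ∈ Q → ∀ vc₁ vc₂ v₁ v₂,
      IsQPSolution qo ds φ c₀ αc df dr l q₁ vc₁ v₁ →
      IsQPSolution qo ds φ c₀ αc df dr l q₂ vc₂ v₂ →
        ‖v₁ - v₂‖ ≤ L * (‖q₁ - q₂‖ + ‖vc₁ - vc₂‖) := by
  obtain ⟨L, hL, hlip⟩ := exists_lipschitz_isNearest l
  obtain ⟨Kφ, hφ⟩ := hd.phi_lipschitz
  obtain ⟨Kα, hα⟩ := hd.alpha_lipschitz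
  have hc₀ := hd.c₀_pos
  set M : ℝ := c₀ * (Kα * (1 + Kφ * r⁻¹)) with hM
  have hM0 : 0 ≤ M := by positivity
  refine ⟨L * (M + 1), by positivity, fun q₁ q₂ hq₁ hq₂ vc₁ vc₂ v₁ v₂ h₁ h₂ => ?_⟩
  have h := hlip _ _ vc₁ vc₂ v₁ v₂ (hfeas q₁ hq₁) (hfeas q₂ hq₂) h₁ h₂
  refine h.trans ?_
  rw [mul_assoc]
  refine mul_le_mul_of_nonneg_left ?_ hL.le
  have hb : ‖(fun k => c₀ * αc (reg qo ds φ df (l k) q₁) - dr) -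
      fun k => c₀ * αc (reg qo ds φ df (l k) q₂) - dr‖ ≤ M * ‖q₁ - q₂‖ := by
    rw [pi_norm_le_iff_of_nonneg (by positivity)]
    intro k
    have e : ((fun k => c₀ * αc (reg qo ds φ df (l k) q₁) - dr) -
      fun k => c₀ * αc (reg qo ds φ df (l k) q₂) - dr) k =
        c₀ * (αc (reg qo ds φ df (l k) q₁) - αc (reg qo ds φ df (l k) q₂)) := by
      simp only [Pi.sub_apply]; ring
    rw [e, norm_mul, Real.norm_of_nonneg hc₀.le, hM, mul_assoc]
    refine mul_le_mul_of_nonneg_left ?_ hc₀.le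
    have h1 := hα.dist_le_mul (reg qo ds φ df (l k) q₁) (reg qo ds φ df (l k) q₂)
    rw [Real.dist_eq, Real.dist_eq] at h1
    rw [Real.norm_eq_abs, mul_assoc]
    exact h1.trans (mul_le_mul_of_nonneg_left
      (reg_lipschitz (hl k) hd.phi_nonneg hφ hr (hQ q₁ hq₁) (hQ q₂ hq₂)) Kα.2)
  have h1 : 0 ≤ ‖q₁ - q₂‖ := norm_nonneg _
  have h2 : 0 ≤ M * ‖vc₁ - vc₂‖ := by positivity
  linarith

end Design

end SafetyQP

theorem proposition3 {n N : ℕ} [NeZero N]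
    (qo : Fin N → SafetyQP.E n) (ds : Fin N → ℝ) (hds : ∀ i, 0 < ds i)
    (da db dh : ℝ) (hobs : SafetyQP.ObstacleDistance qo ds da db dh)
    (vbar dr : ℝ) (hdr : 0 < dr)
    (h1 : da < √2 * SafetyQP.dsMin ds)
    (h2 : 2 * dr < vbar)
    (h3 : 1 - (vbar - 2 * dr) ^ 2 / (2 * (vbar - dr) ^ 2) <
      (2 * SafetyQP.dsMin ds ^ 2 - da ^ 2) / (2 * (SafetyQP.dsMax ds + db / 2) ^ 2)) :
    -- admissible design parameters and a positive basis adapted to them exist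
    (∃ (φ : ℝ → ℝ) (c₀ : ℝ) (αc : ℝ → ℝ) (df : ℝ),
      SafetyQP.IsDesign (SafetyQP.cStar ds da db) db dh vbar dr φ c₀ αc df ∧
      ∃ (m : ℕ) (l : Fin m → SafetyQP.E n), SafetyQP.IsPositiveBasis c₀ l) ∧
    -- and for all admissible design parameters the control law has the following properties
    (∀ (φ : ℝ → ℝ) (c₀ : ℝ) (αc : ℝ → ℝ) (df : ℝ),
      SafetyQP.IsDesign (SafetyQP.cStar ds da db) db dh vbar dr φ c₀ αc df →
      ∃ Δh : ℝ, 0 < Δh ∧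
        ∀ (m : ℕ) (l : Fin m → SafetyQP.E n), SafetyQP.IsPositiveBasis c₀ l →
          -- (a) existence and uniqueness of the solution
          (∀ q, SafetyQP.IsSafe qo ds Δh q → ∀ vc,
            ∃! v, SafetyQP.IsQPSolution qo ds φ c₀ αc df dr l q vc v) ∧
          -- (b) robust barrier inequalities and velocity bound
          (∀ q, SafetyQP.IsSafe qo ds Δh q → ∀ vc v,
            SafetyQP.IsQPSolution qo ds φ c₀ αc df dr l q vc v →
              (∀ (vtilde : SafetyQP.E n) (i : Fin N),
                DifferentiableAt ℝ (SafetyQP.barrier (qo i) (ds i)) q ∧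
                fderiv ℝ (SafetyQP.barrier (qo i) (ds i)) q (v + vtilde) ≥
                  -SafetyQP.alphaP c₀ αc (SafetyQP.barrier (qo i) (ds i) q) + dr - ‖vtilde‖) ∧
              ‖v‖ ≤ vbar - dr) ∧
          -- (c) Lipschitz continuity of the solution map
          (∃ L : ℝ, 0 < L ∧ ∀ q₁ q₂, SafetyQP.IsSafe qo ds Δh q₁ → SafetyQP.IsSafe qo ds Δh q₂ →
            ∀ vc₁ vc₂ v₁ v₂,
              SafetyQP.IsQPSolution qo ds φ c₀ αc df dr l q₁ vc₁ v₁ →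
              SafetyQP.IsQPSolution qo ds φ c₀ αc df dr l q₂ vc₂ v₂ →
                ‖v₁ - v₂‖ ≤ L * (‖q₁ - q₂‖ + ‖vc₁ - vc₂‖))) := by
  open SafetyQP in
  have hmin : 0 < dsMin ds := hobs.da_pos.trans hobs.da_lt
  have hmm := dsMin_le_dsMax ds
  have hdb := hobs.db_pos
  have hc : 0 < cStar ds da db := cStar_pos hobs.da_pos hdb hmin
  have hD : 0 < gap (cStar ds da db) vbar dr := gap_pos hc.le hdr h2
  have hv : 0 < vbar - dr := by linarith
  refine ⟨?_, fun φ c₀ αc df hd => ?_⟩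
  · have h4 : 4 * cStar ds da db < (vbar - 2 * dr) ^ 2 / (vbar - dr) ^ 2 := by
      rw [cStar_eq ds (by linarith)]
      have e1 : (vbar - 2 * dr) ^ 2 / (2 * (vbar - dr) ^ 2) =
          (vbar - 2 * dr) ^ 2 / (vbar - dr) ^ 2 / 2 := by field_simp
      have e2 : (2 * dsMin ds ^ 2 - da ^ 2) / (2 * (dsMax ds + db / 2) ^ 2) =
          (2 * dsMin ds ^ 2 - da ^ 2) / (dsMax ds + db / 2) ^ 2 / 2 := by
        have : 0 < dsMax ds + db / 2 := by linarith
        field_simp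
      rw [e1, e2] at h3
      linarith
    obtain ⟨φ, c₀, αc, df, hd⟩ := exists_isDesign hc.le hdb hobs.dh_pos hdr h2
      (sqrt_add_sqrt_lt_one hc.le hdr h2 h4)
    exact ⟨φ, c₀, αc, df, hd, exists_isPositiveBasis hd.c₀_lt_one⟩
  · have hgt := hd.c₀_gt
    -- The two square roots in `c₀_gt` add up to `2√c* + D`.
    have hslack : 2 * √(cStar ds da db) < c₀ - gap (cStar ds da db) vbar dr := by
      rw [gap]; linarith
    have hs0 := Real.sqrt_nonneg (cStar ds da db)
    have hce : 4 * cStar ds da db < (c₀ - gap (cStar ds da db) vbar dr) ^ 2 := by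
      have h5 := Real.sq_sqrt hc.le
      have h6 := pow_lt_pow_left₀ hslack (by positivity) two_ne_zero
      rw [mul_pow, h5] at h6
      linarith
    obtain ⟨Δ, hΔ0, hΔ, hdir⟩ := exists_safe_margin hobs h1 (by linarith) hce
    have hr : 0 < dsMin ds - Δ := by linarith [hobs.dh_lt]
    refine ⟨Δ, hΔ0, fun m l hl => ?_⟩
    have hfeas : ∀ q, IsSafe qo ds Δ q →
        ∃ u, ∀ k, inner ℝ (l k) u < c₀ * αc (reg qo ds φ df (l k) q) - dr := fun q hq =>
      hd.exists_strictly_feasible hobs.dh_pos hdr hD hΔ hq (hdir q hq) hl.unit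
    refine ⟨fun q hq vc => ?_, fun q hq vc v hsol => ⟨fun vt i => ?_, ?_⟩, ?_⟩
    · obtain ⟨u, hu⟩ := hfeas q hq
      obtain ⟨v, hv⟩ := exists_isNearest vc ⟨u, fun k => (hu k).le⟩
      exact ⟨v, hv, fun w hw => IsNearest.eq hw hv⟩
    · have hqi : q ≠ qo i := by
        have := hr.trans_le (hq.le_norm i)
        rintro rfl
        simp at this
      have hfd := hasFDerivAt_barrier (ds i) hqi
      refine ⟨hfd.differentiableAt, ?_⟩
      have h5 := hd.inner_dir_le hdr hl hsol.1 i hqi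
      have h6 := real_inner_le_norm (dir (qo i) q) vt
      rw [norm_dir hqi, one_mul] at h6
      rw [hfd.fderiv, ge_iff_le, neg_apply, innerSL_apply_apply,
        inner_add_right]
      linarith
    · exact hd.norm_le hobs.dh_pos hdr hD h2 hl hsol.1
    · exact hd.exists_lipschitz hl.unit hr (Q := {q | IsSafe qo ds Δ q})
        (fun q hq i => IsSafe.le_norm hq i) hfeas
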